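/- **Setting.** Work is measured in the asymmetric memory model: a write to the large memory costs $\omega\ge 1$, every other operation costs $1$; a tree node is a record of constantly many words. Let $\alpha\ge 2$ be an integer. The *weight* (size) of a (sub)tree is its number of nodes plus one. **Data structure.** A set of keys is kept in a binary search tree in which only *critical* nodes carry balancing information: the current weight of their subtree and the *initial weight* it had when the node was labelled. When a perfectly balanced (sub)tree is constructed, a node of weight $w$ is labelled critical iff for some integer $i\ge 0$ either $2\alpha^i\le w\le 4\alpha^i-2$, or $w=2\alpha^i-1$ and its sibling has weight $2\alpha^i$; the root of the whole tree is always treated as critical. *Insertion.* Search for the key; if it is absent, attach a new leaf (critical, initial weight $2$) and increment the weights stored at the critical nodes on the search path. If then some critical node on the path has reached twice its initial weight $s$, the subtree of the topmost such node is reconstructed in a perfectly balanced way, in a number of reads and writes linear in its size, and relabelled, except that the new root of a reconstructed proper subtree is not marked if $s\le 4\alpha^i-2$ and $2\alpha^{i+1}-1\le 2s$ for some integer $i\ge 0$. If the key is present but marked as deleted, it is unmarked; if it is already live, nothing changes. *Deletion.* Search for the key and, if it is live, mark it as deleted; marked nodes keep counting towards weights and stay in place when a proper subtree is reconstructed. Once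 at least half of all nodes are marked, the whole tree is reconstructed from the live keys. (Marked nodes are also dropped when the whole tree is reconstructed because the weight of the root has doubled.) **Theorem.** There is an absolute constant $C>0$ such that for every linearly ordered type of keys, every integer $\alpha\ge2$, every real $\omega\ge1$, every finite set $S$ of keys and every finite sequence of $m$ updates (insertions and deletions in any order) performed on the freshly constructed and labelled tree on $S$: 1. after the updates the tree is a search tree whose live keys are exactly those in the set obtained from $S$ by the updates, the number of marked nodes is recorded correctly, the root of a nonempty tree is critical, and each critical node stores its correct current weight, which is at least its initial weight and less than twice its initial weight; 2. the total work of the updates (searching, maintaining the balancing information, and all reconstructions) is at most $$C\sum_{j=1}^{m}(\omega+\alpha)\,\max\{1,\log_\alpha n_j\},$$ where $n_j$ is the number of live keys plus one just before the $j$-th update. That is, the amortized cost per insertion or deletion on a tree of size $n$ is $O((\omega+\alpha)\log_\alpha n)$, where $\log_\alpha n$ is read as $1$ when $n<\alpha$. -/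

import Mathlib

universe u v

namespace AlphaLabeling

/-! ### Cost accounting in the asymmetric memory model

A computation returns its value together with the number of unit-cost steps it performs (reads of
the large memory, each with the constantly many local operations that go with it) and the number of
writes to the large memory. A write costs `ω`, every other step costs `1`. A tree node, an array
cell and a counter are records of constantly many words; accessing one is one read or one write. -/

structure Counted (A : Type u) where
  val : A
  reads : ℕ
  writes : ℕ

namespace Counted

/-- A result at no cost. -/
def ret {A : Type u} (a : A) : Counted A := ⟨a, 0, 0⟩

/-- Perform `r` reads and `w` writes, then run `c`. -/
def charge {A : Type u} (r w : ℕ) (c : Counted A) : Counted A :=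
  ⟨c.val, r + c.reads, w + c.writes⟩

/-- Sequential composition; costs add up. -/
def bind {A : Type u} {B : Type v} (c : Counted A) (f : A → Counted B) : Counted B :=
  ⟨(f c.val).val, c.reads + (f c.val).reads, c.writes + (f c.val).writes⟩

/-- The work: reads plus `ω` times writes. -/
def work {A : Type u} (ω : ℝ) (c : Counted A) : ℝ := (c.reads : ℝ) + ω * (c.writes : ℝ)

end Counted

/-! ### Binary search trees with balancing information at critical nodes only -/

/-- The balancing information of a critical node: the subtree weight at the time when the node was
labelled, and the current subtree weight. -/
structure BalanceInfo where
  initial : ℕ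
  weight : ℕ

/-- A binary tree. A node stores a key, a flag telling whether the key is live (`true`) or marked as
deleted (`false`), and balancing information if and only if it is a critical node
(`none` means: secondary node). -/
inductive LTree (K : Type u) where
  | nil : LTree K
  | node (left : LTree K) (key : K) (live : Bool) (info : Option BalanceInfo) (right : LTree K) :
      LTree K

namespace LTree

variable {K : Type u}

/-- The weight (size) of a subtree: its number of nodes (live or marked) plus one. It is the sum of
the weights of the two children. -/
def weight : LTree K → ℕ
  | nil => 1
  | node l _ _ _ r => l.weight + r.weight

/-- The keys with their flags, in symmetric order. -/
def entries : LTree K → List (K × Bool)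
  | nil => []
  | node l k b _ r => l.entries ++ (k, b) :: r.entries

/-- Every critical node knows its current subtree weight, and that weight is less than twice
the initial weight. -/
def InfoCorrect : LTree K → Prop
  | nil => True
  | node l k b info r =>
      (∀ c ∈ info, c.weight = (node l k b info r).weight ∧
        c.initial ≤ c.weight ∧ c.weight < 2 * c.initial) ∧
      l.InfoCorrect ∧ r.InfoCorrect

/-- The root of a nonempty tree is a (virtual) critical node. -/
def RootCritical : LTree K → Prop
  | nil => True
  | node _ _ _ info _ => info.isSome

end LTree

/-! ### The labeling rule -/

/-- In a freshly constructed tree, a non-root node of weight `w` whose sibling has weight `sib` is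
critical iff for some `i ≥ 0` (1) `2α^i ≤ w ≤ 4α^i - 2`, or (2) `w = 2α^i - 1` and
`sib = 2α^i`. -/
def IsCritical (α w sib : ℕ) : Prop :=
  ∃ i : ℕ, (2 * α ^ i ≤ w ∧ w + 2 ≤ 4 * α ^ i) ∨ (w + 1 = 2 * α ^ i ∧ sib = 2 * α ^ i)

/-- Whether the new root, of weight `w`, is critical after the reconstruction of the subtree of a
non-root critical node with initial weight `s`. At that moment `w = 2 * s` is even, so that only
rule (1) can apply. Exception: the new root is not marked if `s ≤ 4α^i - 2` and
`2α^(i+1) - 1 ≤ 2s` for some `i`. -/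
def IsCriticalAfterRebuild (α s w : ℕ) : Prop :=
  (∃ i : ℕ, 2 * α ^ i ≤ w ∧ w + 2 ≤ 4 * α ^ i) ∧
    ¬ ∃ i : ℕ, s + 2 ≤ 4 * α ^ i ∧ 2 * α ^ (i + 1) ≤ 2 * s + 1

/-! ### Reconstruction -/

section Algorithm

variable {K : Type u}

/-- The label written at a node of weight `w` when it is constructed. -/
def freshInfo (mark : Bool) (w : ℕ) : Option BalanceInfo :=
  if mark then some ⟨w, w⟩ else none

/-- Write the entries of a tree, in order, in front of `acc`. Per node: one read of the node,
one write of the output cell and one write to the traversal stack. -/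
def flatten : LTree K → List (K × Bool) → Counted (List (K × Bool))
  | .nil, acc => Counted.ret acc
  | .node l k b _ r, acc =>
      Counted.charge 1 2 ((flatten r acc).bind fun acc' => flatten l ((k, b) :: acc'))

open scoped Classical in
/-- Construct the perfectly balanced tree with the given entries and label its nodes; `mark` tells
whether the root is critical. The list stands for an array, its sublists for ranges of
indices. Per node: one read of the median of the range, one write of the node and one write to the
recursion stack. The level `i` in the labeling rule changes by at most one from a node to its child,
so that labeling a node takes constantly many local operations. -/
noncomputable def build (α : ℕ) (mark : Bool) (a : List (K × Bool)) : Counted (LTree K) :=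
  match _h : a.drop (a.length / 2) with
  | [] => Counted.ret .nil
  | e :: right =>
      let left := a.take (a.length / 2)
      let wl := left.length + 1
      let wr := right.length + 1
      Counted.charge 1 2
        ((build α (decide (IsCritical α wl wr)) left).bind fun l =>
          (build α (decide (IsCritical α wr wl)) right).bind fun r =>
            Counted.ret (.node l e.1 e.2 (freshInfo mark (wl + wr)) r))
termination_by a.length
decreasing_by
  all_goals
    have h2 := congrArg List.length _h
    simp only [List.length_drop, List.length_cons] at h2
    first
      | (simp only [List.length_take]; omega)
      | omega

open scoped Classical in
/-- Reconstruct the subtree `t` of a non-root critical node with initial weight `s`, relabel it, and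
redirect the pointer to it (one write). Nodes marked as deleted are kept. -/
noncomputable def rebuildSubtree (α s : ℕ) (t : LTree K) : Counted (LTree K) :=
  (flatten t []).bind fun a =>
    Counted.charge 0 1 (build α (decide (IsCriticalAfterRebuild α s (a.length + 1))) a)

/-- Reconstruct the whole tree from its live entries; the root is critical. Dropping the marked
entries is one pass over the array of entries. -/
noncomputable def rebuildAll (α : ℕ) (t : LTree K) : Counted (LTree K) :=
  (flatten t []).bind fun a =>
    Counted.charge a.length (a.length + 1) (build α true (a.filter Prod.snd))

/-! ### Updates -/

variable [LinearOrder K]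

/-- Search for a key: `none` if absent, otherwise its flag. One read per visited node. -/
def search (k : K) : LTree K → Counted (Option Bool)
  | .nil => Counted.charge 1 0 (Counted.ret none)
  | .node l x b _ r =>
      Counted.charge 1 0
        (if k < x then search k l else if x < k then search k r else Counted.ret (some b))

/-- Set the flag of a key that is present. One read per visited node, one write. -/
def setLive (k : K) (live : Bool) : LTree K → Counted (LTree K)
  | .nil => Counted.charge 1 0 (Counted.ret .nil)
  | .node l x b info r =>
      Counted.charge 1 0
        (if k < x then (setLive k live l).bind fun l' => Counted.ret (.node l' x b info r)
         else if x < k then (setLive k live r).bind fun r' => Counted.ret (.node l x b info r')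
         else Counted.charge 0 1 (Counted.ret (.node l x live info r)))

/-- Attach a new leaf for a key that is absent, and increment the weights of the critical nodes on
the search path. The new leaf is critical, with initial weight 2. One read per visited
node, one write per critical node on the path, two writes for the leaf and the pointer to it. -/
def attach (k : K) : LTree K → Counted (LTree K)
  | .nil => Counted.charge 1 2 (Counted.ret (.node .nil k true (some ⟨2, 2⟩) .nil))
  | .node l x b info r =>
      let info' := info.map fun c => (⟨c.initial, c.weight + 1⟩ : BalanceInfo)
      Counted.charge 1 (if info.isSome then 1 else 0)
        (if k < x then (attach k l).bind fun l' => Counted.ret (.node l' x b info' r)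
         else (attach k r).bind fun r' => Counted.ret (.node l x b info' r'))

/-- Whether the weight of a critical node has reached twice its initial weight. -/
def Overflows (c : BalanceInfo) : Prop := 2 * c.initial ≤ c.weight

instance (c : BalanceInfo) : Decidable (Overflows c) := by
  unfold Overflows; infer_instance

/-- Walk down the search path of `k`, from a non-root node, to the topmost critical node that
overflows, and reconstruct its subtree. One read per visited node. -/
noncomputable def rebalance (α : ℕ) (k : K) : LTree K → Counted (LTree K)
  | .nil => Counted.charge 1 0 (Counted.ret .nil)
  | .node l x b info r =>
      let descend :=
        if k < x then (rebalance α k l).bind fun l' => Counted.ret (.node l' x b info r)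
        else if x < k then (rebalance α k r).bind fun r' => Counted.ret (.node l x b info r')
        else Counted.ret (.node l x b info r)
      Counted.charge 1 0
        (match info with
         | none => descend
         | some c =>
             if Overflows c then rebuildSubtree α c.initial (.node l x b info r) else descend)

/-- The balancing information stored at the root (which is critical in all reachable states). -/
def rootInfo : LTree K → BalanceInfo
  | .node _ _ _ (some c) _ => c
  | _ => ⟨1, 1⟩

/-- Rebalance along the search path of `k`, starting at the root: if the root overflows, the whole
tree is reconstructed, otherwise we look for the topmost overflowing node below it. -/
noncomputable def rebalanceBelowRoot (α : ℕ) (k : K) : LTree K → Counted (LTree K)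
  | .nil => Counted.ret .nil
  | .node l x b info r =>
      Counted.charge 1 0
        (if k < x then (rebalance α k l).bind fun l' => Counted.ret (.node l' x b info r)
         else if x < k then (rebalance α k r).bind fun r' => Counted.ret (.node l x b info r')
         else Counted.ret (.node l x b info r))

/-- The data structure: the tree and the number of its nodes that are marked as deleted. -/
structure DynTree (K : Type u) where
  tree : LTree K
  dead : ℕ

/-- Insert a key. Nothing happens if it is live already; if it is marked as deleted, it is revived;
otherwise a leaf is attached and the topmost overflowing critical node is reconstructed. -/
noncomputable def insertKey (α : ℕ) (k : K) (d : DynTree K) : Counted (DynTree K) :=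
  (search k d.tree).bind fun found =>
    match found with
    | some true => Counted.ret d
    | some false =>
        Counted.charge 1 1
          ((setLive k true d.tree).bind fun t => Counted.ret ⟨t, d.dead - 1⟩)
    | none =>
        (attach k d.tree).bind fun t =>
          Counted.charge 1 0
            (if Overflows (rootInfo t) then
              Counted.charge 0 1 ((rebuildAll α t).bind fun t' => Counted.ret ⟨t', 0⟩)
            else (rebalanceBelowRoot α k t).bind fun t' => Counted.ret ⟨t', d.dead⟩)

/-- Delete a key: mark it if it is live. Once at least half of the nodes are marked, the whole tree
is reconstructed from the live keys. -/
noncomputable def deleteKey (α : ℕ) (k : K) (d : DynTree K) : Counted (DynTree K) :=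
  (search k d.tree).bind fun found =>
    match found with
    | some true =>
        (setLive k false d.tree).bind fun t =>
          Counted.charge 2 1
            (if (rootInfo t).weight ≤ 2 * (d.dead + 1) + 1 then
              Counted.charge 0 1 ((rebuildAll α t).bind fun t' => Counted.ret ⟨t', 0⟩)
            else Counted.ret ⟨t, d.dead + 1⟩)
    | _ => Counted.ret d

/-- An update request. -/
inductive Update (K : Type u) where
  | insert (k : K) : Update K
  | delete (k : K) : Update K

/-- Perform one update. -/
noncomputable def Update.perform (α : ℕ) : Update K → DynTree K → Counted (DynTree K)
  | .insert k, d => insertKey α k d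
  | .delete k, d => deleteKey α k d

/-- Perform a sequence of updates; costs add up. -/
noncomputable def performAll (α : ℕ) : List (Update K) → DynTree K → Counted (DynTree K)
  | [], d => Counted.ret d
  | u :: us, d => (u.perform α d).bind fun d' => performAll α us d'

/-- The freshly constructed and labelled tree on a finite set of keys. -/
noncomputable def construct (α : ℕ) (S : Finset K) : DynTree K :=
  ⟨(build α true ((S.sort (· ≤ ·)).map fun k => (k, true))).val, 0⟩

/-- The effect of one update on the represented set of keys. -/
def Update.apply : Update K → Finset K → Finset K
  | .insert k, S => Insert.insert k S
  | .delete k, S => S.erase k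

/-- The effect of a sequence of updates on the represented set of keys. -/
def applyAll (us : List (Update K)) (S : Finset K) : Finset K :=
  us.foldl (fun T u => u.apply T) S

/-- The sizes (number of keys plus one) at the times of the successive updates. -/
def sizes : List (Update K) → Finset K → List ℕ
  | [], _ => []
  | u :: us, S => (S.card + 1) :: sizes us (u.apply S)

/-- The data structure represents `S`: the tree is a search tree whose live keys are the elements of
`S`, the number of marked nodes is recorded, the root is critical, and each critical node holds
correct balancing information. -/
def DynTree.Represents (d : DynTree K) (S : Finset K) : Prop :=
  (d.tree.entries.map Prod.fst).Pairwise (· < ·) ∧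
  (∀ k, (k, true) ∈ d.tree.entries ↔ k ∈ S) ∧
  d.dead = (d.tree.entries.filter fun e => !e.2).length ∧
  d.tree.RootCritical ∧
  d.tree.InfoCorrect

end Algorithm

end AlphaLabeling

/-!
Call a critical node of initial weight `s` with `2α^i - 1 ≤ s ≤ 4α^i - 2` a node of level `i`. The
labelling rule makes the levels drop by exactly one from a critical node to the next critical nodes
below it, and the exception for the new root of a reconstructed subtree is what keeps this true: an
overflowing node of level `i` is replaced by a tree whose topmost critical nodes have level `i`
again. So a search path contains at most `log_α n + O(1)` critical nodes. Between critical nodes of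
levels `i + 1` and `i` it contains `O(α)` others: weights there are less than `8α^(i+1)`, and the
path leaves behind a sibling of weight at least `2α^i - 1` at each step.

The reconstructions are paid for by a potential: the number of insertions below each critical node
since it was labelled, summed over the critical nodes, plus the number of marked nodes. When a
critical node overflows, half of the weight of its subtree has been inserted since it was labelled;
when the deletion of marked nodes is due, half of all nodes are marked; and fresh trees have
potential `0`. An update raises the potential by at most one per critical node on the search path.
-/

namespace AlphaLabeling

attribute [simps] Counted.ret Counted.charge Counted.bind

attribute [grind =] Counted.ret_val Counted.ret_reads Counted.ret_writes Counted.charge_val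
  Counted.charge_reads Counted.charge_writes Counted.bind_val Counted.bind_reads
  Counted.bind_writes

lemma lt_mul_add_one_of_mul_le {h w m i p : ℕ} (hh : h * p ≤ w + m * i * p) (hw : w < m * p) :
    h < m * (i + 1) := by
  refine Nat.lt_of_mul_lt_mul_right (a := p) ?_
  linarith

lemma two_mul_pow_le_pow {α i j : ℕ} (hα : 2 ≤ α) (hij : i < j) : 2 * α ^ i ≤ α ^ j :=
  calc 2 * α ^ i ≤ α * α ^ i := Nat.mul_le_mul_right _ hα
    _ = α ^ (i + 1) := (pow_succ' α i).symm
    _ ≤ α ^ j := Nat.pow_le_pow_right (by omega) hij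

lemma eq_of_pow_lt {α i j : ℕ} (hα : 2 ≤ α) (hij : α ^ i < 2 * α ^ j) (hji : α ^ j < α ^ (i + 1)) :
    j = i := by
  have hle : j < i + 1 := (Nat.pow_lt_pow_iff_right hα).1 hji
  have hge : ¬ j < i := fun hlt => hij.not_ge (two_mul_pow_le_pow hα hlt)
  omega

namespace LTree

variable {K : Type u}

/-- The number of nodes on a longest path from the root. -/
def height : LTree K → ℕ
  | nil => 0
  | node l _ _ _ r => max l.height r.height + 1

/-- The largest number of critical nodes on a path from the root. -/
def criticalDepth : LTree K → ℕ
  | nil => 0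
  | node l _ _ info r => max l.criticalDepth r.criticalDepth + if info.isSome then 1 else 0

/-- The number of insertions below each critical node since it was labelled, summed over all
critical nodes: what the insertions have saved up for the next reconstructions. -/
def potential : LTree K → ℕ
  | nil => 0
  | node l _ _ info r =>
      l.potential + r.potential + info.elim 0 fun c => c.weight - c.initial

lemma weight_eq_length_add_one (t : LTree K) : t.weight = t.entries.length + 1 := by
  induction t with
  | nil => rfl
  | node => simp only [weight, entries, List.length_append, List.length_cons]; omega

lemma height_lt_weight (t : LTree K) : t.height < t.weight := by
  induction t with
  | nil => exact Nat.one_pos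
  | node => simp only [height, weight]; omega

lemma criticalDepth_le_height (t : LTree K) : t.criticalDepth ≤ t.height := by
  induction t with
  | nil => rfl
  | node => simp only [criticalDepth, height]; split <;> omega

end LTree

/-- `s` lies in the range of initial weights of the critical nodes of level `i`. -/
def HasLevel (α i s : ℕ) : Prop := 2 * α ^ i ≤ s + 1 ∧ s + 2 ≤ 4 * α ^ i

namespace LTree

variable {K : Type u} {α i : ℕ} {t : LTree K}

/-- The topmost critical nodes have level `i`, and levels drop by one from a critical node to the
next ones below it. An empty tree has level `0`, and nothing is required below critical nodes of
level `0`. -/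
def Leveled (α : ℕ) : ℕ → LTree K → Prop
  | i, nil => i = 0
  | i, node l _ _ none r => l.Leveled α i ∧ r.Leveled α i
  | 0, node _ _ _ (some c) _ => HasLevel α 0 c.initial
  | i + 1, node l _ _ (some c) r =>
      HasLevel α (i + 1) c.initial ∧ l.Leveled α i ∧ r.Leveled α i

/-- The children of the root have a common level `i`, and the initial weight of the root is at most
that of a critical node of level `i + 1`. -/
def RootLeveled (α : ℕ) : LTree K → Prop
  | nil => True
  | node l _ _ info r =>
      ∃ i, (∀ c ∈ info, c.initial + 2 ≤ 4 * α ^ (i + 1)) ∧ l.Leveled α i ∧ r.Leveled α i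

lemma InfoCorrect.weight_mem_Ico {l r : LTree K} {k : K} {b : Bool} {c : BalanceInfo}
    (hc : (node l k b (some c) r).InfoCorrect) :
    (node l k b (some c) r).weight ∈ Set.Ico c.initial (2 * c.initial) := by
  obtain ⟨hweight, hmem⟩ := hc.1 c rfl
  rwa [hweight] at hmem

lemma InfoCorrect.weight_add_weight_lt {l r : LTree K} {k : K} {b : Bool} {c : BalanceInfo}
    (hc : (node l k b (some c) r).InfoCorrect) (hs : c.initial + 2 ≤ 4 * α ^ (i + 1)) :
    l.weight + r.weight < 8 * α * α ^ i := by
  have hlt := hc.weight_mem_Ico.2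
  rw [weight] at hlt
  rw [pow_succ'] at hs
  linarith

lemma Leveled.two_mul_pow_le_weight_add_one (hα : 0 < α) (ht : t.Leveled α i)
    (hc : t.InfoCorrect) : 2 * α ^ i ≤ t.weight + 1 := by
  have hpos : 0 < α ^ i := Nat.pow_pos hα
  fun_induction Leveled α i t with
  | case1 i => simp [ht, weight]
  | case2 i l _ _ r ihl ihr =>
    have := ihl ht.1 hc.2.1 hpos
    have := ihr ht.2 hc.2.2 hpos
    simp only [weight]
    omega
  | case3 l k b c r => exact ht.1.trans (Nat.succ_le_succ hc.weight_mem_Ico.1)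
  | case4 i l k b c r => exact ht.1.1.trans (Nat.succ_le_succ hc.weight_mem_Ico.1)

lemma Leveled.criticalDepth_le (ht : t.Leveled α i) (hc : t.InfoCorrect) :
    t.criticalDepth ≤ i + 2 := by
  fun_induction Leveled α i t with
  | case1 => simp only [criticalDepth, Nat.zero_le]
  | case2 i l _ _ r ihl ihr =>
    have := ihl ht.1 hc.2.1
    have := ihr ht.2 hc.2.2
    simp only [criticalDepth, Option.isSome_none, Bool.false_eq_true, if_false]
    omega
  | case3 l k b c r =>
    have hdepth := criticalDepth_le_height (node l k b (some c) r)
    have hheight := height_lt_weight (node l k b (some c) r)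
    have hweight := hc.weight_mem_Ico.2
    have hinitial : c.initial + 2 ≤ 4 := ht.2
    omega
  | case4 i l k b c r ihl ihr =>
    have := ihl ht.2.1 hc.2.1
    have := ihr ht.2.2 hc.2.2
    simp only [criticalDepth, Option.isSome_some, if_true]
    omega

lemma Leveled.height_mul_pow_le (hα : 0 < α) (ht : t.Leveled α i) (hc : t.InfoCorrect) :
    t.height * α ^ i ≤ t.weight + 8 * α * i * α ^ i := by
  fun_induction Leveled α i t with
  | case1 => simp only [height, Nat.zero_mul, Nat.zero_le]
  | case2 i l k b r ihl ihr =>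
    have hpos : 0 < α ^ i := Nat.pow_pos hα
    have := ht.1.two_mul_pow_le_weight_add_one hα hc.2.1
    have := ht.2.two_mul_pow_le_weight_add_one hα hc.2.2
    have := ihl ht.1 hc.2.1
    have := ihr ht.2 hc.2.2
    simp only [height, weight, add_mul, max_mul]
    omega
  | case3 l k b c r => simpa using (height_lt_weight _).le
  | case4 i l k b c r ihl ihr =>
    have hw := hc.weight_add_weight_lt ht.1.2
    have := lt_mul_add_one_of_mul_le (ihl ht.2.1 hc.2.1) (by omega)
    have := lt_mul_add_one_of_mul_le (ihr ht.2.2 hc.2.2) (by omega)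
    have hheight : (node l k b (some c) r).height ≤ 8 * α * (i + 1) := by
      rw [height]
      omega
    exact le_add_left (Nat.mul_le_mul_right _ hheight)

lemma RootLeveled.exists_bounds (hα : 0 < α) (ht : t.RootLeveled α) (hroot : t.RootCritical)
    (hc : t.InfoCorrect) :
    ∃ i, 4 * α ^ i ≤ t.weight + 3 ∧ t.criticalDepth ≤ i + 3 ∧ t.height ≤ 8 * α * (i + 1) := by
  match t, ht, hroot with
  | nil, _, _ => exact ⟨0, by simp [weight], Nat.zero_le _, Nat.zero_le _⟩
  | node l k b (some c) r, ⟨i, hs, hl, hr⟩, _ =>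
    have hpos : 0 < α ^ i := Nat.pow_pos hα
    have hw := hc.weight_add_weight_lt (hs c rfl)
    have := hl.two_mul_pow_le_weight_add_one hα hc.2.1
    have := hr.two_mul_pow_le_weight_add_one hα hc.2.2
    have := hl.criticalDepth_le hc.2.1
    have := hr.criticalDepth_le hc.2.2
    have := lt_mul_add_one_of_mul_le (hl.height_mul_pow_le hα hc.2.1) (by omega)
    have := lt_mul_add_one_of_mul_le (hr.height_mul_pow_le hα hc.2.2) (by omega)
    simp only [weight, criticalDepth, height, Option.isSome_some, if_true]
    exact ⟨i, by omega, by omega, by omega⟩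

end LTree

/-! ### Construction -/

section Build

variable {K : Type u} {α i : ℕ}

lemma halving_induction {A : Type*} {P : List A → Prop} (nil : P [])
    (node : ∀ l e r, r.length ≤ l.length → l.length ≤ r.length + 1 → P l → P r →
      P (l ++ e :: r)) (a : List A) : P a := by
  induction hn : a.length using Nat.strong_induction_on generalizing a with
  | h n ih =>
    match h : a.drop (a.length / 2) with
    | [] =>
      have hlen := List.drop_eq_nil_iff.1 h
      rw [List.eq_nil_of_length_eq_zero (l := a) (by omega)]
      exact nil
    | e :: r =>
      have hlen := congrArg List.length h
      rw [List.length_drop, List.length_cons] at hlen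
      have htake : (a.take (a.length / 2)).length = a.length / 2 :=
        List.length_take_of_le (Nat.div_le_self _ _)
      rw [← List.take_append_drop (a.length / 2) a, h]
      exact node _ _ _ (by omega) (by omega) (ih _ (by omega) _ rfl) (ih _ (by omega) _ rfl)

lemma eq_of_mem_freshInfo {mark : Bool} {w : ℕ} {c : BalanceInfo} (hc : c ∈ freshInfo mark w) :
    c = ⟨w, w⟩ := by
  cases mark with
  | false => cases hc
  | true => exact (Option.some.inj hc).symm

lemma build_nil (α : ℕ) (mark : Bool) :
    build α mark ([] : List (K × Bool)) = Counted.ret .nil := by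
  rw [build]
  split
  next => rfl
  next h => simp at h

open scoped Classical in
lemma build_append_cons (α : ℕ) (mark : Bool) {l r : List (K × Bool)} (e : K × Bool)
    (hrl : r.length ≤ l.length) (hlr : l.length ≤ r.length + 1) :
    build α mark (l ++ e :: r) =
      Counted.charge 1 2
        ((build α (decide (IsCritical α (l.length + 1) (r.length + 1))) l).bind fun t =>
          (build α (decide (IsCritical α (r.length + 1) (l.length + 1))) r).bind fun t' =>
            Counted.ret (.node t e.1 e.2
              (freshInfo mark (l.length + 1 + (r.length + 1))) t')) := by
  have hmid : (l ++ e :: r).length / 2 = l.length := by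
    simp only [List.length_append, List.length_cons]
    omega
  rw [build]
  split
  next h =>
    rw [hmid, List.drop_left] at h
    cases h
  next e' r' h =>
    rw [hmid, List.drop_left] at h
    obtain ⟨rfl, rfl⟩ := List.cons.inj h
    simp only [hmid, List.take_left]

lemma build_entries (α : ℕ) (mark : Bool) (a : List (K × Bool)) :
    (build α mark a).val.entries = a := by
  induction a using halving_induction generalizing mark with
  | nil => simp [build_nil, LTree.entries]
  | node l e r hrl hlr ihl ihr => simp [build_append_cons _ _ _ hrl hlr, LTree.entries, ihl, ihr]

lemma build_weight (α : ℕ) (mark : Bool) (a : List (K × Bool)) :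
    (build α mark a).val.weight = a.length + 1 := by
  rw [LTree.weight_eq_length_add_one, build_entries]

lemma build_reads (α : ℕ) (mark : Bool) (a : List (K × Bool)) :
    (build α mark a).reads = a.length := by
  induction a using halving_induction generalizing mark with
  | nil => simp [build_nil]
  | node l e r hrl hlr ihl ihr =>
    simp only [build_append_cons _ _ _ hrl hlr, Counted.charge_reads, Counted.bind_reads,
      Counted.ret_reads, ihl, ihr, List.length_append, List.length_cons]
    omega

lemma build_writes (α : ℕ) (mark : Bool) (a : List (K × Bool)) :
    (build α mark a).writes = 2 * a.length := by
  induction a using halving_induction generalizing mark with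
  | nil => simp [build_nil]
  | node l e r hrl hlr ihl ihr =>
    simp only [build_append_cons _ _ _ hrl hlr, Counted.charge_writes, Counted.bind_writes,
      Counted.ret_writes, ihl, ihr, List.length_append, List.length_cons]
    omega

lemma build_potential (α : ℕ) (mark : Bool) (a : List (K × Bool)) :
    (build α mark a).val.potential = 0 := by
  induction a using halving_induction generalizing mark with
  | nil => simp [build_nil, LTree.potential]
  | node l e r hrl hlr ihl ihr =>
    cases mark <;> simp [build_append_cons _ _ _ hrl hlr, LTree.potential, freshInfo, ihl, ihr]

lemma build_infoCorrect (α : ℕ) (mark : Bool) (a : List (K × Bool)) :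
    (build α mark a).val.InfoCorrect := by
  induction a using halving_induction generalizing mark with
  | nil => rw [build_nil]; trivial
  | node l e r hrl hlr ihl ihr =>
    simp only [build_append_cons _ _ _ hrl hlr, Counted.charge_val, Counted.bind_val,
      Counted.ret_val]
    refine ⟨fun c hc => ?_, ihl _, ihr _⟩
    obtain rfl := eq_of_mem_freshInfo hc
    simp only [LTree.weight, build_weight]
    exact ⟨trivial, le_rfl, by omega⟩

lemma build_rootCritical (α : ℕ) (a : List (K × Bool)) :
    (build α true a).val.RootCritical := by
  induction a using halving_induction with
  | nil => simp [build_nil, LTree.RootCritical]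
  | node l e r hrl hlr =>
    simp [build_append_cons _ _ _ hrl hlr, LTree.RootCritical, freshInfo]

/-- The weights `w` for which the topmost critical nodes of a freshly constructed tree have level
`i`; `mark` tells whether its root is critical. -/
def FreshLevel (α i : ℕ) (mark : Bool) (w : ℕ) : Prop :=
  match mark with
  | true => HasLevel α i w
  | false => 4 * α ^ i ≤ w + 1 ∧ w + 2 ≤ 4 * α ^ (i + 1)

lemma HasLevel.freshLevel_false {w : ℕ} (hα : 2 ≤ α) (h : HasLevel α (i + 1) w) :
    FreshLevel α i false w := by
  have := two_mul_pow_le_pow hα (Nat.lt_add_one i)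
  exact ⟨by have := h.1; omega, h.2⟩

lemma exists_freshLevel_false {w : ℕ} (hα : 2 ≤ α) (hw : 3 ≤ w) : ∃ i, FreshLevel α i false w := by
  have hlow : α ^ Nat.log α ((w + 1) / 4) ≤ (w + 1) / 4 := Nat.pow_log_le_self α (by omega)
  have hhigh : (w + 1) / 4 < α ^ (Nat.log α ((w + 1) / 4) + 1) :=
    Nat.lt_pow_succ_log_self hα _
  exact ⟨Nat.log α ((w + 1) / 4), by omega, by omega⟩

open scoped Classical in
lemma FreshLevel.half {c d : ℕ} (hα : 2 ≤ α) (h : FreshLevel α i false (c + d))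
    (hcd : c ≤ d + 1) (hdc : d ≤ c + 1) :
    FreshLevel α i (decide (IsCritical α c d)) c := by
  obtain ⟨hlow, hhigh⟩ := h
  have hpos : 0 < α ^ i := Nat.pow_pos (by omega)
  by_cases hcrit : IsCritical α c d
  · obtain ⟨j, hj⟩ := id hcrit
    obtain rfl : j = i := eq_of_pow_lt hα (by omega) (by omega)
    simp only [hcrit, decide_true, FreshLevel, HasLevel]
    omega
  · have hi := not_exists.1 hcrit i
    simp only [hcrit, decide_false, FreshLevel]
    omega

open scoped Classical in
lemma HasLevel.freshLevel_rebuild {s : ℕ} (hα : 2 ≤ α) (h : HasLevel α i s) :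
    FreshLevel α i (decide (IsCriticalAfterRebuild α s (2 * s))) (2 * s) := by
  obtain ⟨hlow, hhigh⟩ := h
  have hpos : 0 < α ^ i := Nat.pow_pos (by omega)
  have hsucc := two_mul_pow_le_pow hα (Nat.lt_add_one i)
  by_cases hcrit : IsCriticalAfterRebuild α s (2 * s)
  · obtain ⟨⟨j, hj⟩, hexc⟩ := id hcrit
    have hi := not_exists.1 hexc i
    obtain rfl : j = i := eq_of_pow_lt hα (by omega) (by omega)
    simp only [hcrit, decide_true, FreshLevel, HasLevel]
    omega
  · simp only [hcrit, decide_false, FreshLevel]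
    refine ⟨?_, by omega⟩
    by_contra! hlt
    refine hcrit ⟨⟨i, by omega, by omega⟩, ?_⟩
    rintro ⟨j, hj⟩
    have hsuccj := two_mul_pow_le_pow hα (Nat.lt_add_one j)
    obtain rfl : j = i := eq_of_pow_lt hα (by omega) (by omega)
    omega

lemma FreshLevel.build_leveled {mark : Bool} {a : List (K × Bool)} (hα : 2 ≤ α)
    (h : FreshLevel α i mark (a.length + 1)) : (build α mark a).val.Leveled α i := by
  induction a using halving_induction generalizing mark i with
  | nil =>
    have hpos : 0 < α ^ i := Nat.pow_pos (by omega)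
    have hlow : 2 * α ^ i ≤ 2 := by
      cases mark
      · exact le_trans (by omega) h.1
      · exact h.1
    rw [build_nil]
    by_contra hi
    have := two_mul_pow_le_pow hα (Nat.pos_of_ne_zero hi)
    rw [pow_zero] at this
    omega
  | node l e r hrl hlr ihl ihr =>
    have hchildren {i : ℕ} (h : FreshLevel α i false (l.length + 1 + (r.length + 1))) :=
      And.intro (ihl (h.half hα (by omega) (by omega)))
        (ihr ((Nat.add_comm _ _ ▸ h).half hα (by omega) (by omega)))
    have hlen : (l ++ e :: r).length + 1 = l.length + 1 + (r.length + 1) := by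
      simp only [List.length_append, List.length_cons]
      omega
    rw [hlen] at h
    rw [build_append_cons _ _ _ hrl hlr]
    match mark, i, h with
    | false, i, h => exact hchildren h
    | true, 0, h => exact h
    | true, i + 1, h => exact ⟨h, hchildren (h.freshLevel_false hα)⟩

lemma build_rootLeveled (hα : 2 ≤ α) (mark : Bool) (a : List (K × Bool)) :
    (build α mark a).val.RootLeveled α := by
  induction a using halving_induction with
  | nil => rw [build_nil]; trivial
  | node l e r hrl hlr =>
    rw [build_append_cons _ _ _ hrl hlr]
    obtain hl | hl := Nat.eq_zero_or_pos l.length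
    · obtain rfl := List.eq_nil_of_length_eq_zero hl
      obtain rfl := List.eq_nil_of_length_eq_zero (Nat.le_zero.1 hrl)
      refine ⟨0, ?_, ?_, ?_⟩
      · rintro c hc
        obtain rfl := eq_of_mem_freshInfo hc
        exact Nat.le_mul_of_pos_right 4 (Nat.pow_pos (by omega))
      all_goals simp [build_nil, LTree.Leveled]
    · obtain ⟨i, hi⟩ :=
        exists_freshLevel_false (w := l.length + 1 + (r.length + 1)) hα (by omega)
      refine ⟨i, ?_, ?_, ?_⟩
      · rintro c hc
        obtain rfl := eq_of_mem_freshInfo hc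
        exact hi.2
      · exact (hi.half hα (by omega) (by omega)).build_leveled hα
      · exact ((Nat.add_comm _ _ ▸ hi).half hα (by omega) (by omega)).build_leveled hα

end Build

/-! ### Reconstruction -/

section Reconstruction

variable {K : Type u} {α i : ℕ}

lemma flatten_val (t : LTree K) (acc : List (K × Bool)) :
    (flatten t acc).val = t.entries ++ acc := by
  induction t generalizing acc with
  | nil => rfl
  | node l k b info r ihl ihr =>
    simp only [flatten, Counted.charge_val, Counted.bind_val, ihl, ihr, LTree.entries,
      List.append_assoc, List.cons_append]

lemma flatten_reads (t : LTree K) (acc : List (K × Bool)) :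
    (flatten t acc).reads = t.entries.length := by
  induction t generalizing acc with
  | nil => rfl
  | node l k b info r ihl ihr =>
    simp only [flatten, Counted.charge_reads, Counted.bind_reads, ihl, ihr, LTree.entries,
      List.length_append, List.length_cons]
    omega

lemma flatten_writes (t : LTree K) (acc : List (K × Bool)) :
    (flatten t acc).writes = 2 * t.entries.length := by
  induction t generalizing acc with
  | nil => rfl
  | node l k b info r ihl ihr =>
    simp only [flatten, Counted.charge_writes, Counted.bind_writes, ihl, ihr, LTree.entries,
      List.length_append, List.length_cons]
    omega

open scoped Classical in
lemma rebuildSubtree_val (α s : ℕ) (t : LTree K) :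
    (rebuildSubtree α s t).val =
      (build α (decide (IsCriticalAfterRebuild α s t.weight)) t.entries).val := by
  simp only [rebuildSubtree, Counted.bind_val, Counted.charge_val, flatten_val, List.append_nil,
    LTree.weight_eq_length_add_one]

lemma rebuildSubtree_reads_le (α s : ℕ) (t : LTree K) :
    (rebuildSubtree α s t).reads ≤ 2 * t.weight := by
  simp only [rebuildSubtree, Counted.bind_reads, Counted.charge_reads, flatten_reads, flatten_val,
    List.append_nil, build_reads, LTree.weight_eq_length_add_one]
  omega

lemma rebuildSubtree_writes_le (α s : ℕ) (t : LTree K) :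
    (rebuildSubtree α s t).writes ≤ 4 * t.weight := by
  simp only [rebuildSubtree, Counted.bind_writes, Counted.charge_writes, flatten_writes,
    flatten_val, List.append_nil, build_writes, LTree.weight_eq_length_add_one]
  omega

lemma rebuildSubtree_leveled {s : ℕ} {t : LTree K} (hα : 2 ≤ α) (hs : HasLevel α i s)
    (ht : t.weight = 2 * s) : (rebuildSubtree α s t).val.Leveled α i := by
  rw [rebuildSubtree_val, ht]
  refine FreshLevel.build_leveled hα ?_
  rw [← LTree.weight_eq_length_add_one, ht]
  exact hs.freshLevel_rebuild hα

lemma rebuildAll_val (α : ℕ) (t : LTree K) :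
    (rebuildAll α t).val = (build α true (t.entries.filter Prod.snd)).val := by
  simp only [rebuildAll, Counted.bind_val, Counted.charge_val, flatten_val, List.append_nil]

lemma rebuildAll_potential (α : ℕ) (t : LTree K) : (rebuildAll α t).val.potential = 0 := by
  rw [rebuildAll_val, build_potential]

lemma rebuildAll_reads_le (α : ℕ) (t : LTree K) : (rebuildAll α t).reads ≤ 3 * t.weight := by
  have := List.length_filter_le Prod.snd t.entries
  simp only [rebuildAll, Counted.bind_reads, Counted.charge_reads, flatten_reads, flatten_val,
    List.append_nil, build_reads, LTree.weight_eq_length_add_one]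
  omega

lemma rebuildAll_writes_le (α : ℕ) (t : LTree K) : (rebuildAll α t).writes ≤ 5 * t.weight := by
  have := List.length_filter_le Prod.snd t.entries
  simp only [rebuildAll, Counted.bind_writes, Counted.charge_writes, flatten_writes, flatten_val,
    List.append_nil, build_writes, LTree.weight_eq_length_add_one]
  omega

end Reconstruction

/-! ### Searching and attaching leaves -/

section Search

variable {K : Type u} [LinearOrder K] {k : K} {t : LTree K} {α i : ℕ}

namespace LTree

/-- The keys increase in symmetric order. -/
def Sorted (t : LTree K) : Prop := (t.entries.map Prod.fst).Pairwise (· < ·)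

lemma sorted_node {l r : LTree K} {x : K} {b : Bool} {info : Option BalanceInfo} :
    (node l x b info r).Sorted ↔
      l.Sorted ∧ r.Sorted ∧ (∀ e ∈ l.entries, e.1 < x) ∧ ∀ e ∈ r.entries, x < e.1 := by
  simp only [Sorted, entries, List.map_append, List.map_cons, List.pairwise_append,
    List.pairwise_cons, List.mem_cons, List.forall_mem_map, forall_eq_or_imp]
  constructor
  · rintro ⟨hl, ⟨hxr, hr⟩, hlr⟩
    exact ⟨hl, hr, fun e he => (hlr e he).1, hxr⟩
  · rintro ⟨hl, hr, hlx, hxr⟩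
    exact ⟨hl, ⟨hxr, hr⟩, fun e he => ⟨hlx e he, fun e' he' => (hlx e he).trans (hxr e' he')⟩⟩

end LTree

lemma search_eq_some_iff (ht : t.Sorted) {b : Bool} :
    (search k t).val = some b ↔ (k, b) ∈ t.entries := by
  fun_induction search k t with
  | case1 => simp [LTree.entries]
  | case2 l x b' info r ih =>
    obtain ⟨hl, hr, hlx, hxr⟩ := LTree.sorted_node.1 ht
    simp only [LTree.entries, List.mem_append, List.mem_cons, Prod.mk.injEq]
    split_ifs <;> grind

lemma search_reads_le (k : K) (t : LTree K) : (search k t).reads ≤ t.height + 1 := by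
  fun_induction search k t with
  | case1 => simp
  | case2 l x b' info r =>
    simp only [LTree.height]
    split_ifs <;> grind

lemma search_writes (k : K) (t : LTree K) : (search k t).writes = 0 := by
  fun_induction search k t <;> grind

section SetLive

variable (k : K) (v : Bool) (t : LTree K)

lemma setLive_weight : (setLive k v t).val.weight = t.weight := by
  fun_induction setLive k v t with grind [LTree.weight]

lemma setLive_potential : (setLive k v t).val.potential = t.potential := by
  fun_induction setLive k v t with grind [LTree.potential]

lemma setLive_reads_le : (setLive k v t).reads ≤ t.height + 1 := by
  fun_induction setLive k v t with grind [LTree.height]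

lemma setLive_writes_le : (setLive k v t).writes ≤ 1 := by
  fun_induction setLive k v t with grind

lemma setLive_keys : (setLive k v t).val.entries.map Prod.fst = t.entries.map Prod.fst := by
  fun_induction setLive k v t with grind [LTree.entries]

lemma setLive_length_entries : (setLive k v t).val.entries.length = t.entries.length := by
  simpa only [List.length_map] using congrArg List.length (setLive_keys k v t)

variable {k v t}

lemma setLive_sorted (ht : t.Sorted) : (setLive k v t).val.Sorted := by
  rwa [LTree.Sorted, setLive_keys]

lemma setLive_infoCorrect (ht : t.InfoCorrect) : (setLive k v t).val.InfoCorrect := by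
  fun_induction setLive k v t with grind [LTree.InfoCorrect, LTree.weight, setLive_weight]

lemma setLive_rootCritical (ht : t.RootCritical) : (setLive k v t).val.RootCritical := by
  cases t <;> grind [LTree.RootCritical, setLive]

lemma setLive_leveled (ht : t.Leveled α i) : (setLive k v t).val.Leveled α i := by
  fun_induction LTree.Leveled α i t with grind [LTree.Leveled, setLive]

lemma setLive_rootLeveled (ht : t.RootLeveled α) : (setLive k v t).val.RootLeveled α := by
  cases t <;> grind [LTree.RootLeveled, setLive, setLive_leveled]

lemma mem_setLive_entries (ht : t.Sorted) {b : Bool} (hk : (k, b) ∈ t.entries) {e : K × Bool} :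
    e ∈ (setLive k v t).val.entries ↔ e = (k, v) ∨ e ∈ t.entries ∧ e.1 ≠ k := by
  fun_induction setLive k v t with
  | case1 => cases hk
  | case2 l x b' info r ihr ihl =>
    obtain ⟨hl, hr, hlx, hxr⟩ := LTree.sorted_node.1 ht
    grind [LTree.entries]

end SetLive

section Attach

lemma attach_ne_nil : (attach k t).val ≠ .nil := by
  cases t <;> grind [attach]

lemma attach_weight : (attach k t).val.weight = t.weight + 1 := by
  fun_induction attach k t with grind [LTree.weight]

lemma attach_height_le : (attach k t).val.height ≤ t.height + 1 := by
  fun_induction attach k t with grind [LTree.height]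

lemma attach_reads_le : (attach k t).reads ≤ t.height + 1 := by
  fun_induction attach k t with grind [LTree.height]

lemma attach_writes_le : (attach k t).writes ≤ t.criticalDepth + 2 := by
  fun_induction attach k t with grind [LTree.criticalDepth]

lemma attach_potential_le : (attach k t).val.potential ≤ t.potential + t.criticalDepth := by
  fun_induction attach k t with
  | case1 => simp [LTree.potential]
  | case2 l x b info r =>
    cases info <;> grind [LTree.potential, LTree.criticalDepth]

lemma attach_entries_perm : (attach k t).val.entries.Perm ((k, true) :: t.entries) := by
  fun_induction attach k t with
  | case1 => rfl
  | case2 l x b info r => grind [LTree.entries]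

lemma attach_sorted (ht : t.Sorted) (hk : ∀ b, (k, b) ∉ t.entries) :
    (attach k t).val.Sorted := by
  fun_induction attach k t with
  | case1 => simp [LTree.Sorted, LTree.entries]
  | case2 l x b info r info' ihr ihl =>
    obtain ⟨hl, hr, hlx, hxr⟩ := LTree.sorted_node.1 ht
    have hmeml (e) := (attach_entries_perm (k := k) (t := l)).mem_iff (a := e)
    have hmemr (e) := (attach_entries_perm (k := k) (t := r)).mem_iff (a := e)
    grind [LTree.sorted_node, LTree.entries]

lemma attach_leveled (ht : t.Leveled α i) : (attach k t).val.Leveled α i := by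
  fun_induction LTree.Leveled α i t with grind [LTree.Leveled, attach, HasLevel]

lemma attach_rootCritical (ht : t.RootCritical) : (attach k t).val.RootCritical := by
  cases t <;> grind [LTree.RootCritical, attach]

lemma attach_rootLeveled (hα : 0 < α) (ht : t.RootLeveled α) :
    (attach k t).val.RootLeveled α := by
  cases t with
  | nil => exact ⟨0, by simpa [attach] using Nat.succ_le_of_lt hα, rfl, rfl⟩
  | node l x b info r =>
    obtain ⟨i, hinfo, hl, hr⟩ := ht
    cases info <;> grind [LTree.RootLeveled, attach, attach_leveled]

end Attach
end Search

/-! ### Rebalancing -/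

section Rebalancing

variable {K : Type u} [LinearOrder K] {k : K} {t : LTree K} {α i : ℕ}

namespace LTree

/-- The state between attaching a leaf for `k` and rebalancing: as `InfoCorrect`, except that the
weights of critical nodes on the search path of `k` may have reached twice the initial weights. -/
def NearlyCorrect (k : K) : LTree K → Prop
  | nil => True
  | node l x b info r =>
      (∀ c ∈ info, c.weight = (node l x b info r).weight ∧
        c.initial ≤ c.weight ∧ c.weight ≤ 2 * c.initial) ∧
      (if k < x then l.NearlyCorrect k else l.InfoCorrect) ∧
      (if x < k then r.NearlyCorrect k else r.InfoCorrect)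

lemma NearlyCorrect.weight_eq_of_overflows {l r : LTree K} {x : K} {b : Bool} {c : BalanceInfo}
    (ht : (node l x b (some c) r).NearlyCorrect k) (hc : Overflows c) :
    (node l x b (some c) r).weight = 2 * c.initial := by
  grind [NearlyCorrect, Overflows]

lemma NearlyCorrect.weight_le_two_mul_potential (ht : t.NearlyCorrect k)
    (hroot : Overflows (rootInfo t)) : t.weight ≤ 2 * t.potential := by
  cases t with
  | nil => grind [rootInfo, Overflows]
  | node l x b info r =>
    cases info <;> grind [rootInfo, NearlyCorrect, Overflows, potential]

end LTree

lemma attach_nearlyCorrect (ht : t.InfoCorrect) (hk : ∀ b, (k, b) ∉ t.entries) :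
    (attach k t).val.NearlyCorrect k := by
  fun_induction attach k t with
  | case1 => simp [LTree.NearlyCorrect, LTree.InfoCorrect, LTree.weight]
  | case2 l x b info r info' ihr ihl =>
    cases info <;>
    grind [LTree.NearlyCorrect, LTree.InfoCorrect, LTree.entries, LTree.weight, attach_weight]

lemma rebalance_entries (α : ℕ) (k : K) (t : LTree K) :
    (rebalance α k t).val.entries = t.entries := by
  induction t with
  | nil => rfl
  | node l x b info r ihl ihr =>
    cases info <;> grind [rebalance, LTree.entries, rebuildSubtree_val, build_entries]

lemma rebalance_weight (α : ℕ) (k : K) (t : LTree K) :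
    (rebalance α k t).val.weight = t.weight := by
  simp only [LTree.weight_eq_length_add_one, rebalance_entries]

lemma rebalance_infoCorrect (ht : t.NearlyCorrect k) : (rebalance α k t).val.InfoCorrect := by
  induction t with
  | nil => trivial
  | node l x b info r ihl ihr =>
    cases info <;>
      grind [rebalance, LTree.InfoCorrect, LTree.NearlyCorrect, Overflows, rebuildSubtree_val,
        build_infoCorrect, rebalance_weight, LTree.weight]

lemma rebalance_leveled (hα : 2 ≤ α) (hlevel : t.Leveled α i) (ht : t.NearlyCorrect k) :
    (rebalance α k t).val.Leveled α i := by
  fun_induction LTree.Leveled α i t with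
  | case1 => exact hlevel
  | case2 => grind [rebalance, LTree.Leveled, LTree.NearlyCorrect]
  | case3 l x b c r =>
    by_cases hc : Overflows c
    · have := rebuildSubtree_leveled hα hlevel (ht.weight_eq_of_overflows hc)
      grind [rebalance]
    · grind [rebalance, LTree.Leveled]
  | case4 i l x b c r ihl ihr =>
    by_cases hc : Overflows c
    · have := rebuildSubtree_leveled hα hlevel.1 (ht.weight_eq_of_overflows hc)
      grind [rebalance]
    · grind [rebalance, LTree.Leveled, LTree.NearlyCorrect]

lemma rebalance_reads_add_potential_le (ht : t.NearlyCorrect k) :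
    (rebalance α k t).reads + 10 * (rebalance α k t).val.potential ≤
      10 * t.potential + t.height + 1 := by
  induction t with
  | nil => simp [rebalance, LTree.potential]
  | node l x b info r ihl ihr =>
    have hrebuild := fun s => rebuildSubtree_reads_le α s (.node l x b info r)
    have hpot := ht.weight_le_two_mul_potential
    cases info <;> grind [rebalance, LTree.NearlyCorrect, LTree.potential, LTree.height,
      rebuildSubtree_val, build_potential, rootInfo]

lemma rebalance_writes_add_potential_le (ht : t.NearlyCorrect k) :
    (rebalance α k t).writes + 10 * (rebalance α k t).val.potential ≤ 10 * t.potential := by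
  induction t with
  | nil => simp [rebalance, LTree.potential]
  | node l x b info r ihl ihr =>
    have hrebuild := fun s => rebuildSubtree_writes_le α s (.node l x b info r)
    have hpot := ht.weight_le_two_mul_potential
    cases info <;> grind [rebalance, LTree.NearlyCorrect, LTree.potential,
      rebuildSubtree_val, build_potential, rootInfo]

lemma rebalance_rootLeveled (hα : 2 ≤ α) (hlevel : t.RootLeveled α) (ht : t.NearlyCorrect k)
    (hroot : ¬ Overflows (rootInfo t)) : (rebalance α k t).val.RootLeveled α := by
  cases t with
  | nil => trivial
  | node l x b info r =>
    obtain ⟨i, hinfo, hl, hr⟩ := hlevel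
    cases info <;>
      grind [rebalance, LTree.RootLeveled, LTree.NearlyCorrect, rebalance_leveled, rootInfo]

lemma rebalanceBelowRoot_eq_rebalance (ht : t ≠ .nil) (hroot : ¬ Overflows (rootInfo t)) :
    rebalanceBelowRoot α k t = rebalance α k t := by
  cases t with
  | nil => exact absurd rfl ht
  | node l x b info r => cases info <;> grind [rebalanceBelowRoot, rebalance, rootInfo]

lemma rebalance_rootCritical (ht : t.RootCritical) (hroot : ¬ Overflows (rootInfo t)) :
    (rebalance α k t).val.RootCritical := by
  cases t with
  | nil => trivial
  | node l x b info r => cases info <;> grind [LTree.RootCritical, rebalance, rootInfo]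

end Rebalancing

/-! ### The invariant -/

section Balance

variable {K : Type u} {t : LTree K} {α : ℕ}

/-- The balancing invariant: correct balancing information, placed on levels. -/
structure LTree.Balanced (α : ℕ) (t : LTree K) : Prop where
  infoCorrect : t.InfoCorrect
  rootCritical : t.RootCritical
  rootLeveled : t.RootLeveled α

lemma build_balanced (hα : 2 ≤ α) (a : List (K × Bool)) : (build α true a).val.Balanced α :=
  ⟨build_infoCorrect α true a, build_rootCritical α a, build_rootLeveled hα true a⟩

lemma rebuildAll_balanced (hα : 2 ≤ α) (t : LTree K) : (rebuildAll α t).val.Balanced α :=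
  rebuildAll_val α t ▸ build_balanced hα _

lemma LTree.Balanced.rootInfo_weight (ht : t.Balanced α) : (rootInfo t).weight = t.weight := by
  match t, ht.rootCritical, ht.infoCorrect with
  | .nil, _, _ => rfl
  | .node _ _ _ (some c) _, _, hc => exact (hc.1 c rfl).1

end Balance

section Representation

variable {K : Type u} [LinearOrder K] {k : K} {t : LTree K} {S : Finset K} {dead α : ℕ}

lemma LTree.Sorted.eq_of_mem_of_mem {b b' : Bool} (ht : t.Sorted) (hb : (k, b) ∈ t.entries)
    (hb' : (k, b') ∈ t.entries) : b = b' :=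
  Option.some.inj (((search_eq_some_iff ht).2 hb).symm.trans ((search_eq_some_iff ht).2 hb'))

lemma LTree.Sorted.card_eq_length_filter (ht : t.Sorted) (hS : ∀ k, (k, true) ∈ t.entries ↔ k ∈ S) :
    S.card = (t.entries.filter Prod.snd).length := by
  have hnodup : ((t.entries.filter Prod.snd).map Prod.fst).Nodup :=
    (List.Pairwise.imp ne_of_lt ht).sublist (List.filter_sublist.map _)
  rw [← List.length_map (f := Prod.fst), ← List.toFinset_card_of_nodup hnodup]
  congr 1
  ext k
  simp [← hS]

/-- `t` is a search tree whose live keys are the elements of `S`, and it has `dead` more nodes: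
those marked as deleted. -/
structure LTree.Stores (t : LTree K) (S : Finset K) (dead : ℕ) : Prop where
  sorted : t.Sorted
  live_iff : ∀ k, (k, true) ∈ t.entries ↔ k ∈ S
  length_eq : t.entries.length = S.card + dead

namespace LTree.Stores

lemma dead_eq (ht : t.Stores S dead) : dead = (t.entries.filter fun e => !e.2).length := by
  have hcard := ht.sorted.card_eq_length_filter ht.live_iff
  have hlen := List.length_eq_length_filter_add (l := t.entries) Prod.snd
  have := ht.length_eq
  omega

lemma weight_eq (ht : t.Stores S dead) : t.weight = S.card + dead + 1 := by
  rw [weight_eq_length_add_one, ht.length_eq]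

lemma of_entries_eq {t' : LTree K} (ht : t.Stores S dead) (h : t'.entries = t.entries) :
    t'.Stores S dead where
  sorted := by rw [Sorted, h]; exact ht.sorted
  live_iff := by rw [h]; exact ht.live_iff
  length_eq := by rw [h]; exact ht.length_eq

lemma attach (ht : t.Stores S dead) (hk : ∀ b, (k, b) ∉ t.entries) :
    (attach k t).val.Stores (insert k S) dead where
  sorted := attach_sorted ht.sorted hk
  live_iff x := by
    rw [attach_entries_perm.mem_iff, List.mem_cons, ht.live_iff, Finset.mem_insert,
      Prod.mk.injEq, and_iff_left rfl]
  length_eq := by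
    rw [attach_entries_perm.length_eq, List.length_cons, ht.length_eq,
      Finset.card_insert_of_notMem ((ht.live_iff k).not.1 (hk true))]
    omega

lemma setLive_true (ht : t.Stores S dead) (hk : (k, false) ∈ t.entries) :
    (setLive k true t).val.Stores (insert k S) (dead - 1) where
  sorted := setLive_sorted ht.sorted
  live_iff x := by grind [mem_setLive_entries, ht.sorted, ht.live_iff]
  length_eq := by
    have hkS : k ∉ S := fun h =>
      Bool.false_ne_true (ht.sorted.eq_of_mem_of_mem hk ((ht.live_iff k).2 h))
    have hdead : 0 < dead := by
      rw [ht.dead_eq]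
      exact List.length_pos_of_mem (List.mem_filter.2 ⟨hk, rfl⟩)
    rw [setLive_length_entries, ht.length_eq, Finset.card_insert_of_notMem hkS]
    omega

lemma setLive_false (ht : t.Stores S dead) (hk : (k, true) ∈ t.entries) :
    (setLive k false t).val.Stores (S.erase k) (dead + 1) where
  sorted := setLive_sorted ht.sorted
  live_iff x := by grind [mem_setLive_entries, ht.sorted, ht.live_iff]
  length_eq := by
    have := Finset.card_erase_add_one ((ht.live_iff k).1 hk)
    rw [setLive_length_entries, ht.length_eq]
    omega

lemma rebuildAll (ht : t.Stores S dead) : (rebuildAll α t).val.Stores S 0 where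
  sorted := by
    rw [Sorted, rebuildAll_val, build_entries]
    exact ht.sorted.sublist (List.filter_sublist.map _)
  live_iff x := by
    rw [rebuildAll_val, build_entries, List.mem_filter, and_iff_left rfl, ht.live_iff]
  length_eq := by
    rw [rebuildAll_val, build_entries, ht.sorted.card_eq_length_filter ht.live_iff, Nat.add_zero]

end LTree.Stores

namespace LTree.Balanced

lemma setLive {v : Bool} (ht : t.Balanced α) : (setLive k v t).val.Balanced α :=
  ⟨setLive_infoCorrect ht.infoCorrect, setLive_rootCritical ht.rootCritical,
    setLive_rootLeveled ht.rootLeveled⟩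

lemma rebalance_attach (hα : 2 ≤ α) (ht : t.Balanced α) (hk : ∀ b, (k, b) ∉ t.entries)
    (hroot : ¬ Overflows (rootInfo (attach k t).val)) :
    (rebalance α k (attach k t).val).val.Balanced α :=
  have hnearly := attach_nearlyCorrect ht.infoCorrect hk
  ⟨rebalance_infoCorrect hnearly,
    rebalance_rootCritical (attach_rootCritical ht.rootCritical) hroot,
    rebalance_rootLeveled hα (attach_rootLeveled (by omega) ht.rootLeveled) hnearly hroot⟩

end LTree.Balanced

namespace DynTree

variable {d : DynTree K}

/-- The invariant of the data structure: at most half of the nodes are marked as deleted. -/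
structure Valid (α : ℕ) (d : DynTree K) (S : Finset K) : Prop where
  stores : d.tree.Stores S d.dead
  balanced : d.tree.Balanced α
  dead_le_card : d.dead ≤ S.card

/-- What has been saved up for reconstructions: the insertions since labelling, for the overflow of
critical nodes, and the marked nodes, for the removal of marked nodes. -/
def potential (d : DynTree K) : ℕ := d.tree.potential + d.dead

lemma Valid.represents (hd : d.Valid α S) : d.Represents S :=
  ⟨hd.stores.sorted, hd.stores.live_iff, hd.stores.dead_eq, hd.balanced.rootCritical,
    hd.balanced.infoCorrect⟩

lemma Valid.exists_bounds (hα : 0 < α) (hd : d.Valid α S) :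
    ∃ i, α ^ i ≤ S.card + 1 ∧ d.tree.criticalDepth ≤ i + 3 ∧ d.tree.height ≤ 8 * α * (i + 1) := by
  obtain ⟨i, hi, hdepth, hheight⟩ :=
    hd.balanced.rootLeveled.exists_bounds hα hd.balanced.rootCritical hd.balanced.infoCorrect
  have hweight := hd.stores.weight_eq
  have hdead := hd.dead_le_card
  exact ⟨i, by omega, hdepth, hheight⟩

end DynTree

lemma construct_valid (hα : 2 ≤ α) (S : Finset K) : (construct α S).Valid α S where
  stores :=
    { sorted := by
        simpa [construct, LTree.Sorted, build_entries, Function.comp_def]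
          using S.sortedLT_sort.pairwise
      live_iff := by simp [construct, build_entries]
      length_eq := by simp [construct, build_entries] }
  balanced := build_balanced hα _
  dead_le_card := Nat.zero_le _

lemma construct_potential (α : ℕ) (S : Finset K) : (construct α S).potential = 0 := by
  simp only [construct, DynTree.potential, build_potential]

end Representation

/-! ### Amortized cost of one update -/

section Amortization

variable {K : Type u} [LinearOrder K] {k : K} {t : LTree K} {S : Finset K} {d : DynTree K} {α : ℕ}

/-- Apart from what the potential of `d` pays for, `c` takes a bounded number of walks along a
search path of `d` and of writes per critical node on it; its result represents `S`. The factor `10`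
is there because a reconstruction takes at most `5` writes per unit of weight and a tree that is due
for one has potential at least half of its weight, up to a constant. -/
structure AmortizedStep (α : ℕ) (d : DynTree K) (c : Counted (DynTree K)) (S : Finset K) :
    Prop where
  valid : c.val.Valid α S
  reads_le : c.reads + 10 * c.val.potential ≤
    10 * d.potential + (10 * d.tree.criticalDepth + 3 * d.tree.height + 14)
  writes_le : c.writes + 10 * c.val.potential ≤
    10 * d.potential + (11 * d.tree.criticalDepth + 18)

lemma rebuildAll_valid {dead : ℕ} (hα : 2 ≤ α) (ht : t.Stores S dead) :
    DynTree.Valid α ⟨(rebuildAll α t).val, 0⟩ S :=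
  ⟨ht.rebuildAll, rebuildAll_balanced hα t, Nat.zero_le _⟩

lemma insertKey_step_of_live (hd : d.Valid α S) (hk : (k, true) ∈ d.tree.entries) :
    AmortizedStep α d (insertKey α k d) (insert k S) := by
  have hsearch := (search_eq_some_iff hd.stores.sorted).2 hk
  have hreads := search_reads_le k d.tree
  have hwrites := search_writes k d.tree
  rw [Finset.insert_eq_of_mem ((hd.stores.live_iff k).1 hk)]
  constructor <;> grind [insertKey, search_reads_le, search_writes]

lemma insertKey_step_of_marked (hd : d.Valid α S) (hk : (k, false) ∈ d.tree.entries) :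
    AmortizedStep α d (insertKey α k d) (insert k S) := by
  have hsearch := (search_eq_some_iff hd.stores.sorted).2 hk
  have hcard := Finset.card_le_card (Finset.subset_insert k S)
  have hdead := hd.dead_le_card
  have hvalid : DynTree.Valid α ⟨(setLive k true d.tree).val, d.dead - 1⟩ (insert k S) :=
    ⟨hd.stores.setLive_true hk, hd.balanced.setLive, by dsimp only; omega⟩
  constructor <;>
    grind [insertKey, DynTree.potential, search_reads_le, search_writes, setLive_potential,
      setLive_reads_le, setLive_writes_le]

lemma insertKey_step_of_absent (hα : 2 ≤ α) (hd : d.Valid α S)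
    (hk : ∀ b, (k, b) ∉ d.tree.entries) : AmortizedStep α d (insertKey α k d) (insert k S) := by
  have hsearch : (search k d.tree).val = none :=
    Option.eq_none_iff_forall_ne_some.2 fun b hb =>
      hk b ((search_eq_some_iff hd.stores.sorted).1 hb)
  have hstores := hd.stores.attach hk
  have hnearly := attach_nearlyCorrect hd.balanced.infoCorrect hk
  by_cases hroot : Overflows (rootInfo (attach k d.tree).val)
  · have hvalid := rebuildAll_valid hα hstores
    have hweight := hnearly.weight_le_two_mul_potential hroot
    constructor <;>
      grind [insertKey, DynTree.potential, search_reads_le, search_writes, attach_reads_le,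
        attach_writes_le, attach_potential_le, rebuildAll_reads_le, rebuildAll_writes_le,
        rebuildAll_potential]
  · have hvalid :
        DynTree.Valid α ⟨(rebalance α k (attach k d.tree).val).val, d.dead⟩ (insert k S) :=
      ⟨hstores.of_entries_eq (rebalance_entries α k _),
        hd.balanced.rebalance_attach hα hk hroot,
        hd.dead_le_card.trans (Finset.card_le_card (Finset.subset_insert k S))⟩
    have hreads := rebalance_reads_add_potential_le hnearly (α := α)
    have hwrites := rebalance_writes_add_potential_le hnearly (α := α)
    rw [← rebalanceBelowRoot_eq_rebalance attach_ne_nil hroot] at hvalid hreads hwrites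
    constructor <;>
      grind [insertKey, DynTree.potential, search_reads_le, search_writes, attach_reads_le,
        attach_writes_le, attach_potential_le, attach_height_le]

lemma deleteKey_step_of_live (hα : 2 ≤ α) (hd : d.Valid α S) (hk : (k, true) ∈ d.tree.entries) :
    AmortizedStep α d (deleteKey α k d) (S.erase k) := by
  have hsearch := (search_eq_some_iff hd.stores.sorted).2 hk
  have hstores := hd.stores.setLive_false hk
  have hbalanced : (setLive k false d.tree).val.Balanced α := hd.balanced.setLive
  have hrootInfo := hbalanced.rootInfo_weight
  have hweight := hstores.weight_eq
  by_cases hrebuild : (rootInfo (setLive k false d.tree).val).weight ≤ 2 * (d.dead + 1) + 1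
  · have hvalid := rebuildAll_valid hα hstores
    constructor <;>
      grind [deleteKey, DynTree.potential, search_reads_le, search_writes, setLive_reads_le,
        setLive_writes_le, rebuildAll_reads_le, rebuildAll_writes_le, rebuildAll_potential]
  · have hvalid : DynTree.Valid α ⟨(setLive k false d.tree).val, d.dead + 1⟩ (S.erase k) :=
      ⟨hstores, hbalanced, by dsimp only; omega⟩
    constructor <;>
      grind [deleteKey, DynTree.potential, search_reads_le, search_writes, setLive_potential,
        setLive_reads_le, setLive_writes_le]

lemma deleteKey_step_of_not_live (hd : d.Valid α S) (hk : (k, true) ∉ d.tree.entries) :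
    AmortizedStep α d (deleteKey α k d) (S.erase k) := by
  have hsearch := (search_eq_some_iff hd.stores.sorted).not.2 hk
  rw [Finset.erase_eq_of_notMem ((hd.stores.live_iff k).not.1 hk)]
  constructor <;> grind [deleteKey, search_reads_le, search_writes]

lemma perform_step (hα : 2 ≤ α) (hd : d.Valid α S) (u : Update K) :
    AmortizedStep α d (u.perform α d) (u.apply S) := by
  match u with
  | .insert k =>
    by_cases hlive : (k, true) ∈ d.tree.entries
    · exact insertKey_step_of_live hd hlive
    by_cases hmarked : (k, false) ∈ d.tree.entries
    · exact insertKey_step_of_marked hd hmarked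
    · exact insertKey_step_of_absent hα hd (Bool.forall_bool.2 ⟨hmarked, hlive⟩)
  | .delete k =>
    by_cases hlive : (k, true) ∈ d.tree.entries
    · exact deleteKey_step_of_live hα hd hlive
    · exact deleteKey_step_of_not_live hd hlive

end Amortization

/-! ### Total work -/

section WorkBound

/-- `log_α n`, read as `1` when `n < α`. -/
noncomputable def logSize (α n : ℕ) : ℝ := max 1 (Real.logb α n)

lemma one_le_logSize (α n : ℕ) : 1 ≤ logSize α n := le_max_left _ _

lemma le_logSize_of_pow_le {α n i : ℕ} (hα : 2 ≤ α) (h : α ^ i ≤ n) : (i : ℝ) ≤ logSize α n := by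
  have hα' : (1 : ℝ) < α := by exact_mod_cast hα
  have hn : 0 < n := (Nat.pow_pos (by omega)).trans_le h
  refine le_max_of_le_right ((Real.le_logb_iff_rpow_le hα' (by exact_mod_cast hn)).2 ?_)
  rw [Real.rpow_natCast]
  exact_mod_cast h

lemma Counted.work_bind {A : Type u} {B : Type v} (ω : ℝ) (c : Counted A) (f : A → Counted B) :
    (c.bind f).work ω = c.work ω + (f c.val).work ω := by
  simp only [work, bind_reads, bind_writes, Nat.cast_add]
  ring

variable {K : Type u} [LinearOrder K] {S T : Finset K} {d : DynTree K} {α : ℕ} {ω : ℝ}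

lemma AmortizedStep.work_add_potential_le {c : Counted (DynTree K)} (hα : 2 ≤ α) (hω : 0 ≤ ω)
    (hd : d.Valid α S) (hc : AmortizedStep α d c T) :
    c.work ω + 10 * (1 + ω) * c.val.potential ≤
      10 * (1 + ω) * d.potential + 75 * ((ω + α) * logSize α (S.card + 1)) := by
  obtain ⟨i, hi, hdepth, hheight⟩ := hd.exists_bounds (by omega)
  have hlevel := le_logSize_of_pow_le hα hi
  have hone := one_le_logSize α (S.card + 1)
  set L := logSize α (S.card + 1)
  have hα' : (2 : ℝ) ≤ α := by exact_mod_cast hα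
  have hreads : (c.reads : ℝ) + 10 * c.val.potential ≤
      10 * d.potential + (10 * (i + 3) + 3 * (8 * α * (i + 1)) + 14) := by
    exact_mod_cast hc.reads_le.trans (by omega)
  have hwrites : (c.writes : ℝ) + 10 * c.val.potential ≤
      10 * d.potential + (11 * (i + 3) + 18) := by
    exact_mod_cast hc.writes_le.trans (by omega)
  have hreads' : (c.reads : ℝ) + 10 * c.val.potential ≤ 10 * d.potential + 75 * (α * L) := by
    nlinarith
  have hwrites' : (c.writes : ℝ) + 10 * c.val.potential ≤ 10 * d.potential + 75 * L := by
    linarith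
  calc c.work ω + 10 * (1 + ω) * c.val.potential
      = (c.reads + 10 * c.val.potential) + ω * (c.writes + 10 * c.val.potential) := by
        rw [Counted.work]; ring
    _ ≤ (10 * d.potential + 75 * (α * L)) + ω * (10 * d.potential + 75 * L) := by gcongr
    _ = 10 * (1 + ω) * d.potential + 75 * ((ω + α) * L) := by ring

lemma performAll_valid (hα : 2 ≤ α) (hd : d.Valid α S) (us : List (Update K)) :
    (performAll α us d).val.Valid α (applyAll us S) := by
  induction us generalizing d S with
  | nil => exact hd
  | cons u _ ih => exact ih (perform_step hα hd u).valid

lemma performAll_work_add_potential_le (hα : 2 ≤ α) (hω : 0 ≤ ω) (hd : d.Valid α S)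
    (us : List (Update K)) :
    (performAll α us d).work ω + 10 * (1 + ω) * (performAll α us d).val.potential ≤
      10 * (1 + ω) * d.potential +
        75 * ((sizes us S).map fun n : ℕ => (ω + α) * logSize α n).sum := by
  induction us generalizing d S with
  | nil => simp [performAll, sizes, Counted.work]
  | cons u us ih =>
    have hstep := perform_step hα hd u
    have hhead := hstep.work_add_potential_le hα hω hd
    have htail := ih hstep.valid
    simp only [performAll, Counted.work_bind, Counted.bind_val, sizes, List.map_cons, List.sum_cons]
    linarith

end WorkBound

end AlphaLabeling

theorem mainTheorem5_general :
    ∃ C : ℝ, 0 < C ∧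
      ∀ (K : Type u) [LinearOrder K] (α : ℕ) (ω : ℝ), 2 ≤ α → 0 ≤ ω →
        ∀ (S : Finset K) (us : List (AlphaLabeling.Update K)),
          (AlphaLabeling.performAll α us
              (AlphaLabeling.construct α S)).val.Represents (AlphaLabeling.applyAll us S) ∧
          (AlphaLabeling.performAll α us (AlphaLabeling.construct α S)).work ω ≤
            C * ((AlphaLabeling.sizes us S).map fun n : ℕ =>
              (ω + (α : ℝ)) * max 1 (Real.logb (α : ℝ) (n : ℝ))).sum := by
  refine ⟨75, by norm_num, fun K _ α ω hα hω S us => ?_⟩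
  have hvalid := AlphaLabeling.construct_valid hα S
  have hwork := AlphaLabeling.performAll_work_add_potential_le hα hω hvalid us
  rw [AlphaLabeling.construct_potential, Nat.cast_zero, mul_zero, zero_add] at hwork
  exact ⟨(AlphaLabeling.performAll_valid hα hvalid us).represents,
    (le_add_of_nonneg_right (by positivity)).trans hwork⟩

theorem mainTheorem5 :
    ∃ C : ℝ, 0 < C ∧
      ∀ (K : Type u) [LinearOrder K] (α : ℕ) (ω : ℝ), 2 ≤ α → 1 ≤ ω →
        ∀ (S : Finset K) (us : List (AlphaLabeling.Update K)),
          (AlphaLabeling.performAll α us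
              (AlphaLabeling.construct α S)).val.Represents (AlphaLabeling.applyAll us S) ∧
          (AlphaLabeling.performAll α us (AlphaLabeling.construct α S)).work ω ≤
            C * ((AlphaLabeling.sizes us S).map fun n : ℕ =>
              (ω + (α : ℝ)) * max 1 (Real.logb (α : ℝ) (n : ℝ))).sum :=
  let ⟨C, hC, h⟩ := mainTheorem5_general
  ⟨C, hC, fun K _ α ω hα hω => h K α ω hα (zero_le_one.trans hω)⟩
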